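/- Let $A$ be a finite set and let $\Sigma_A$ be the group of permutations of $A$. A strict partial order $<$ on $A$ is \emph{semi-linear} if there are $l\ge 0$ and a surjection $h:A\to\{1,\dots,l\}$ with $a<b\iff h(a)<h(b)$. A \emph{double order} on $A$ is a pair $d=(<^x,<^y)$ of strict partial orders on $A$ such that any two distinct elements of $A$ are comparable by $<^x$ or by $<^y$. It is \emph{regular} if $<^x$ is semi-linear and no two elements of $A$ are comparable by both $<^x$ and $<^y$; it is \emph{semi-regular} if there are finitely many (at least one) regular double orders $d_1,\dots,d_k$ such that $<^x$ is the transitive closure of $\bigcup_i <^x_i$ and $<^y$ is the transitive closure of $\bigcup_i <^y_i$. Let $R(A)$ and $R^+(A)$ be the sets of regular and of semi-regular double orders on $A$. The group $\Sigma_A$ acts on both from the right by $d\sigma=(<^x\sigma,<^y\sigma)$, where $a\,({<}\sigma)\,b\iff\sigma(a)<\sigma(b)$. Define $$d_1\subseteq d_2\iff {<^x_1}\subseteq{<^x_2}\text{ and }{<^y_1}\subseteq{<^y_2},\qquad d_1\sqsubseteq d_2\iff {<^x_1}\subseteq{<^x_2}\text{ and }{<^y_1}\supseteq{<^y_2}.$$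 For strict partial orders $<_1,<_2$ let $a\,({<_1}\setminus{<_2})\,b$ mean that $a<_1b$ and that $a,b$ are not comparable by $<_2$. Then $$F:(R^+(A),\subseteq)\to(R(A),\sqsubseteq),\qquad F(<^x,<^y)=(<^x,\ {<^y}\setminus{<^x})$$ is an order-preserving map. For a poset $P$ let $|P|$ be the geometric realization of its order complex, and let $\mathrm{sd}(P)$ be the poset of non-empty finite chains of $P$ ordered by inclusion. Then $$G:\mathrm{sd}(R(A),\sqsubseteq)\to(R^+(A),\subseteq),\qquad G(d_0\sqsubset d_1\sqsubset\dots\sqsubset d_r)=\bigcup_{i=0}^r d_i=(<^x_r,<^y_0)$$ is an order-preserving map as well. \textbf{Proposition.} The map $|F|:|(R^+(A),\subseteq)|\to|(R(A),\sqsubseteq)|$ and the composite $$|(R(A),\sqsubseteq)|\cong|\mathrm{sd}(R(A),\sqsubseteq)|\xrightarrow{\ |G|\ }|(R^+(A),\subseteq)|,$$ whose first map is the inverse of the canonical homeomorphism $|\mathrm{sd}(P)|\to|P|$ (which sends the vertex $c$ to the barycenter of the simplex spanned by the chain $c$ and is affine on simplices), are mutually inverse $\Sigma_A$-homotopy equivalences: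 both are $\Sigma_A$-equivariant, and both of their composites are homotopic to the respective identity maps through $\Sigma_A$-equivariant maps. -/

import Mathlib

/-! ## Geometric realization of finite posets and barycentric subdivision -/

/-- The geometric realization `|P|` of a finite poset `P` (the realization of its order complex), in
barycentric coordinates: formal convex combinations of elements of `P` whose support is a chain,
with the subspace topology from `P → ℝ`. -/
def PosetRealization (P : Type*) [Fintype P] [PartialOrder P] : Type _ :=
  {x : stdSimplex ℝ P // IsChain (· ≤ ·) {p : P | x p ≠ 0}}

namespace PosetRealization

instance (P : Type*) [Fintype P] [PartialOrder P] : TopologicalSpace (PosetRealization P) :=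
  instTopologicalSpaceSubtype

/-- The barycentric coordinate of a point of `|P|` at an element of `P`. -/
def coord {P : Type*} [Fintype P] [PartialOrder P] (x : PosetRealization P) (p : P) : ℝ :=
  x.1 p

theorem coord_injective {P : Type*} [Fintype P] [PartialOrder P] :
    Function.Injective (coord : PosetRealization P → P → ℝ) := by
  intro x y h
  exact Subtype.ext (stdSimplex.ext h)

theorem continuous_coord {P : Type*} [Fintype P] [PartialOrder P] :
    Continuous (coord : PosetRealization P → P → ℝ) :=
  continuous_subtype_val.comp continuous_subtype_val

instance (P : Type*) [Fintype P] [PartialOrder P] : T2Space (PosetRealization P) :=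
  inferInstanceAs
    (T2Space {x : stdSimplex ℝ P // IsChain (· ≤ ·) {p : P | x p ≠ 0}})

instance (P : Type*) [Fintype P] [PartialOrder P] : CompactSpace (PosetRealization P) := by
  have h : {x : stdSimplex ℝ P | IsChain (· ≤ ·) {p : P | x p ≠ 0}} =
      ⋂ (p : P) (q : P) (_ : ¬ (p ≤ q ∨ q ≤ p)), {x : stdSimplex ℝ P | x p * x q = 0} := by
    ext x
    simp only [Set.mem_iInter, Set.mem_ofPred_eq]
    constructor
    · intro hx p q hpq
      by_contra h0
      have h1 := left_ne_zero_of_mul h0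
      have h2 := right_ne_zero_of_mul h0
      exact hpq (hx.total h1 h2)
    · intro hx p hp q hq _
      by_contra hpq
      exact mul_ne_zero hp hq (hx p q hpq)
  have hc : IsClosed {x : stdSimplex ℝ P | IsChain (· ≤ ·) {p : P | x p ≠ 0}} := by
    rw [h]
    refine isClosed_iInter fun p => isClosed_iInter fun q => isClosed_iInter fun _ => ?_
    have hp : ∀ r : P, Continuous fun x : stdSimplex ℝ P => x r := fun r =>
      (continuous_apply r).comp continuous_subtype_val
    exact isClosed_eq ((hp p).mul (hp q)) continuous_const
  exact isCompact_iff_compactSpace.mp hc.isCompact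

/-- The map `|f| : |P| → |Q|` induced by an order-preserving map `f : P → Q`: the affine extension
of `f` over the simplices, i.e. the coordinate of `|f| x` at `q` is the sum of the coordinates of
`x` over the fibre of `f` at `q`. -/
noncomputable def map {P Q : Type*} [Fintype P] [PartialOrder P] [Fintype Q] [PartialOrder Q]
    (f : P →o Q) : C(PosetRealization P, PosetRealization Q) where
  toFun x := ⟨stdSimplex.map f x.1, by
    have key : ∀ q, (stdSimplex.map f x.1) q ≠ 0 → ∃ p, x.1 p ≠ 0 ∧ f p = q := by
      classical
      intro q hq
      rw [stdSimplex.map_coe, FunOnFinite.linearMap_apply_apply] at hq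
      obtain ⟨p, hp, hne⟩ := Finset.exists_ne_zero_of_sum_ne_zero hq
      exact ⟨p, hne, by simpa using hp⟩
    intro a ha b hb _
    obtain ⟨p, hp, rfl⟩ := key a ha
    obtain ⟨q, hq, rfl⟩ := key b hb
    exact (x.2.total hp hq).imp (fun h => f.monotone h) (fun h => f.monotone h)⟩
  continuous_toFun :=
    ((stdSimplex.continuous_map (S := ℝ) f).comp continuous_subtype_val).subtype_mk _

/-- The translation by a group element as an order-preserving map. -/
def smulHom {G P : Type*} [Group G] [PartialOrder P] [MulAction G P]
    [CovariantClass G P (· • ·) (· ≤ ·)] (g : G) : P →o P where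
  toFun p := g • p
  monotone' _ _ h := CovariantClass.elim g h

/-- The action on `|P|` induced by an order-preserving action on `P`. -/
noncomputable instance {G P : Type*} [Group G] [Fintype P] [PartialOrder P] [MulAction G P]
    [CovariantClass G P (· • ·) (· ≤ ·)] : MulAction G (PosetRealization P) where
  smul g x := map (smulHom g) x
  one_smul x := Subtype.ext <| by
    have h : ((smulHom (1 : G) : P →o P) : P → P) = id := funext fun p => one_smul G p
    change stdSimplex.map (smulHom (1 : G) : P →o P) x.1 = x.1
    rw [h, stdSimplex.map_id_apply]
  mul_smul g g' x := Subtype.ext <| by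
    have h : ((smulHom (g * g') : P →o P) : P → P) =
        (smulHom g : P →o P) ∘ (smulHom g' : P →o P) := funext fun p => mul_smul g g' p
    change stdSimplex.map (smulHom (g * g') : P →o P) x.1 =
      stdSimplex.map (smulHom g : P →o P) (stdSimplex.map (smulHom g' : P →o P) x.1)
    rw [h, stdSimplex.map_comp_apply]

end PosetRealization

/-- The barycentric subdivision of a poset: its nonempty finite chains, ordered by inclusion. -/
abbrev PosetSd (P : Type*) [PartialOrder P] : Type _ := PartialOrder.NonemptyFiniteChains P

namespace PosetSd

noncomputable instance (P : Type*) [Fintype P] [PartialOrder P] : Fintype (PosetSd P) :=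
  @Fintype.ofFinite _ (Finite.of_injective
    (PartialOrder.NonemptyFiniteChains.finset : PosetSd P → Finset P)
    (fun _ _ h => PartialOrder.NonemptyFiniteChains.ext h))

section

theorem card_pos {P : Type*} [PartialOrder P] (c : PosetSd P) :
    (0 : ℝ) < (c.finset.card : ℝ) := by
  exact_mod_cast c.nonempty.card_pos

variable {P : Type*} [Fintype P] [PartialOrder P]

open scoped Classical in
/-- For weights `y` on chains, the combination of the barycenters of the chains with weights `y`:
each chain `c` distributes its weight equally among its elements. -/
noncomputable def baryFun (y : PosetSd P → ℝ) (p : P) : ℝ :=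
  ∑ c : PosetSd P, if p ∈ c.finset then y c / (c.finset.card : ℝ) else 0

theorem baryFun_nonneg {y : PosetSd P → ℝ} (hy : ∀ c, 0 ≤ y c) (p : P) : 0 ≤ baryFun y p := by
  classical
  refine Finset.sum_nonneg fun c _ => ?_
  split_ifs
  · exact div_nonneg (hy c) (card_pos c).le
  · exact le_rfl

theorem sum_baryFun (y : PosetSd P → ℝ) : ∑ p, baryFun y p = ∑ c, y c := by
  classical
  unfold baryFun
  rw [Finset.sum_comm]
  refine Finset.sum_congr rfl fun c _ => ?_
  rw [Finset.sum_ite_mem, Finset.univ_inter, Finset.sum_const, nsmul_eq_mul]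
  have := card_pos c
  field_simp

theorem exists_of_baryFun_ne_zero {y : PosetSd P → ℝ} {p : P} (h : baryFun y p ≠ 0) :
    ∃ c : PosetSd P, y c ≠ 0 ∧ p ∈ c.finset := by
  classical
  obtain ⟨c, -, hc⟩ := Finset.exists_ne_zero_of_sum_ne_zero h
  by_cases hp : p ∈ c.finset
  · rw [if_pos hp] at hc
    exact ⟨c, fun h0 => hc (by simp [h0]), hp⟩
  · rw [if_neg hp] at hc
    exact absurd rfl hc

theorem isChain_baryFun {y : PosetSd P → ℝ} (hy : IsChain (· ≤ ·) {c | y c ≠ 0}) :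
    IsChain (· ≤ ·) {p | baryFun y p ≠ 0} := by
  intro p hp q hq _
  obtain ⟨c, hc, hpc⟩ := exists_of_baryFun_ne_zero hp
  obtain ⟨d, hd, hqd⟩ := exists_of_baryFun_ne_zero hq
  rcases hy.total hc hd with h | h
  · exact d.comparable ⟨p, h hpc⟩ ⟨q, hqd⟩
  · exact c.comparable ⟨p, hpc⟩ ⟨q, h hqd⟩

theorem exists_mem_forall_le {y : PosetSd P → ℝ} (hy : IsChain (· ≤ ·) {c | y c ≠ 0})
    (C : PosetSd P) :
    ∃ p ∈ C.finset, ∀ c : PosetSd P, y c ≠ 0 → p ∈ c.finset → C ≤ c := by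
  classical
  set N : Finset (PosetSd P) := {c | y c ≠ 0 ∧ ¬ C ≤ c} with hN
  rcases N.eq_empty_or_nonempty with h0 | hne
  · obtain ⟨p, hp⟩ := C.nonempty
    refine ⟨p, hp, fun c hc _ => ?_⟩
    by_contra hcc
    have : c ∈ N := by simp only [hN, Finset.mem_filter_univ]; exact ⟨hc, hcc⟩
    simp [h0] at this
  · obtain ⟨M, hM, hmax⟩ := N.exists_maximal hne
    have hM' : y M ≠ 0 ∧ ¬ C ≤ M := by simpa [hN] using hM
    obtain ⟨p, hpC, hpM⟩ := Finset.not_subset.mp hM'.2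
    refine ⟨p, hpC, fun c hc hpc => ?_⟩
    by_contra hcc
    have hcN : c ∈ N := by simp only [hN, Finset.mem_filter_univ]; exact ⟨hc, hcc⟩
    have hcM : c ≤ M := by
      rcases hy.total hc hM'.1 with h | h
      · exact h
      · exact hmax hcN h
    exact hpM (hcM hpc)

theorem baryFun_injective_aux {y z : PosetSd P → ℝ} (hy0 : ∀ c, 0 ≤ y c)
    (hz : IsChain (· ≤ ·) {c | z c ≠ 0})
    (C : PosetSd P) (hC : ∀ c, C < c → y c = z c) (hlt : z C < y C) :
    baryFun y ≠ baryFun z := by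
  classical
  obtain ⟨p, hpC, hp⟩ := exists_mem_forall_le hz C
  intro h
  refine absurd (congrFun h p) (ne_of_gt ?_)
  refine Finset.sum_lt_sum (fun c _ => ?_) ⟨C, Finset.mem_univ _, ?_⟩
  · by_cases hpc : p ∈ c.finset
    · rw [if_pos hpc, if_pos hpc]
      refine div_le_div_of_nonneg_right ?_ (card_pos c).le
      by_cases hzc : z c = 0
      · rw [hzc]; exact hy0 c
      · rcases (hp c hzc hpc).eq_or_lt with h1 | h1
        · rw [← h1]; exact hlt.le
        · exact (hC c h1).ge
    · rw [if_neg hpc, if_neg hpc]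
  · rw [if_pos hpC, if_pos hpC]
    exact div_lt_div_of_pos_right hlt (card_pos C)

theorem baryFun_injective {y z : PosetSd P → ℝ} (hy0 : ∀ c, 0 ≤ y c) (hz0 : ∀ c, 0 ≤ z c)
    (hy : IsChain (· ≤ ·) {c | y c ≠ 0}) (hz : IsChain (· ≤ ·) {c | z c ≠ 0})
    (h : baryFun y = baryFun z) : y = z := by
  classical
  by_contra hne
  obtain ⟨c₀, hc₀⟩ := Function.ne_iff.mp hne
  obtain ⟨C, hC, hmax⟩ := ({c | y c ≠ z c} : Finset (PosetSd P)).exists_maximal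
    ⟨c₀, by simpa using hc₀⟩
  have hC' : y C ≠ z C := by simpa using hC
  have hgt : ∀ c, C < c → y c = z c := by
    intro c hc
    by_contra hcne
    exact hc.not_ge (hmax (by simpa using hcne) hc.le)
  rcases lt_or_gt_of_ne hC' with hlt | hlt
  · exact baryFun_injective_aux hz0 hy C (fun c hc => (hgt c hc).symm) hlt h.symm
  · exact baryFun_injective_aux hy0 hz C hgt hlt h

theorem baryFun_surjective_aux (n : ℕ) : ∀ x : P → ℝ, (∀ p, 0 ≤ x p) →
    IsChain (· ≤ ·) {p | x p ≠ 0} → Set.ncard {p | x p ≠ 0} ≤ n →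
    ∃ y : PosetSd P → ℝ, (∀ c, 0 ≤ y c) ∧ IsChain (· ≤ ·) {c | y c ≠ 0} ∧
      (∀ c, y c ≠ 0 → ∀ p ∈ c.finset, x p ≠ 0) ∧ baryFun y = x := by
  classical
  induction n with
  | zero =>
    intro x _ _ hn
    have hx : ∀ p, x p = 0 := by
      intro p
      by_contra hp
      have he := (Set.ncard_eq_zero (Set.toFinite _)).mp (Nat.le_zero.mp hn)
      have : p ∈ {p | x p ≠ 0} := hp
      rw [he] at this
      exact this
    refine ⟨fun _ => 0, fun _ => le_rfl, fun a ha => absurd rfl ha, fun a ha => absurd rfl ha, ?_⟩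
    funext p
    simp [baryFun, hx]
  | succ n ih =>
    intro x hx0 hx hn
    set S : Finset P := {p | x p ≠ 0} with hS
    have hmemS : ∀ p, p ∈ S ↔ x p ≠ 0 := fun p => by simp [hS]
    rcases S.eq_empty_or_nonempty with h0 | hne
    · refine ih x hx0 hx ?_
      have : {p | x p ≠ 0} = ∅ := by
        ext p
        have := hmemS p
        simp only [h0, Finset.notMem_empty, false_iff] at this
        simpa using this
      rw [this]
      simp
    · obtain ⟨q, hqS, hqmin⟩ := S.exists_min_image x hne
      set C : PosetSd P := ⟨S, hne, fun a b =>
        hx.total ((hmemS _).mp a.2) ((hmemS _).mp b.2)⟩ with hCdef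
      set x' : P → ℝ := fun p => if p ∈ S then x p - x q else 0 with hx'
      have hsub : ∀ p, x' p ≠ 0 → p ∈ S ∧ p ≠ q := by
        intro p hp
        by_cases hpS : p ∈ S
        · refine ⟨hpS, ?_⟩
          rintro rfl
          simp [hx'] at hp
        · simp [hx', hpS] at hp
      have hqpos : 0 < x q := lt_of_le_of_ne (hx0 q) ((hmemS q).mp hqS).symm
      obtain ⟨y, hy0, hyc, hysub, hyx⟩ := ih x'
        (fun p => by
          by_cases hpS : p ∈ S
          · simp only [hx', if_pos hpS]
            linarith [hqmin p hpS]
          · simp [hx', hpS])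
        (fun a ha b hb hab => hx ((hmemS a).mp (hsub a ha).1) ((hmemS b).mp (hsub b hb).1) hab)
        (by
          have hlt : Set.ncard {p | x' p ≠ 0} < Set.ncard {p | x p ≠ 0} := by
            refine Set.ncard_lt_ncard ⟨fun p hp => (hmemS p).mp (hsub p hp).1, fun hss => ?_⟩
              (Set.toFinite _)
            exact (hsub q (hss ((hmemS q).mp hqS))).2 rfl
          omega)
      have hyC : ∀ c, y c ≠ 0 → c ≤ C := fun c hc p hp => (hsub p (hysub c hc p hp)).1
      have hyC0 : y C = 0 := by
        by_contra hne0
        exact (hsub q (hysub C hne0 q hqS)).2 rfl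
      refine ⟨fun c => y c + if c = C then x q * (C.finset.card : ℝ) else 0, ?_, ?_, ?_, ?_⟩
      · intro c
        have := hy0 c
        have := card_pos C
        dsimp only
        split_ifs <;> positivity
      · intro a ha b hb hab
        by_cases haC : a = C
        · right
          rw [haC]
          refine hyC b ?_
          have hbC : b ≠ C := fun h => hab (haC.trans h.symm)
          simpa [hbC] using hb
        · have ha' : y a ≠ 0 := by simpa [haC] using ha
          by_cases hbC : b = C
          · rw [hbC]
            exact Or.inl (hyC a ha')
          · have hb' : y b ≠ 0 := by simpa [hbC] using hb
            exact hyc ha' hb' hab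
      · intro c hc p hp
        by_cases hcC : c = C
        · subst hcC
          exact (hmemS p).mp hp
        · have hc' : y c ≠ 0 := by simpa [hcC] using hc
          exact (hmemS p).mp (hyC c hc' hp)
      · funext p
        have h1 : baryFun (fun c => y c + if c = C then x q * (C.finset.card : ℝ) else 0) p =
            baryFun y p + if p ∈ C.finset then x q else 0 := by
          unfold baryFun
          have hsplit : ∀ c : PosetSd P,
              (if p ∈ c.finset then
                (y c + if c = C then x q * (C.finset.card : ℝ) else 0) / (c.finset.card : ℝ)
                else 0) =
              (if p ∈ c.finset then y c / (c.finset.card : ℝ) else 0) +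
                if c = C then (if p ∈ C.finset then x q else 0) else 0 := by
            intro c
            have hcp := card_pos c
            by_cases hpc : p ∈ c.finset
            · by_cases hcC : c = C
              · subst hcC
                simp only [hpc, if_true]
                field_simp
              · simp [hpc, hcC]
            · by_cases hcC : c = C
              · subst hcC
                simp [hpc]
              · simp [hpc, hcC]
          rw [Finset.sum_congr rfl fun c _ => hsplit c, Finset.sum_add_distrib,
            Finset.sum_ite_eq' Finset.univ C, if_pos (Finset.mem_univ C)]
        rw [h1, hyx]
        change x' p + (if p ∈ S then x q else 0) = x p
        by_cases hpS : p ∈ S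
        · simp [hx', hpS]
        · have : x p = 0 := by
            by_contra h
            exact hpS ((hmemS p).mpr h)
          simp [hx', hpS, this]

/-- The canonical map `|sd P| → |P|`, sending the vertex `c` of `|sd P|` to the barycenter of the
simplex of `|P|` spanned by the chain `c` and affine on every simplex of `|sd P|`. -/
noncomputable def baryMap (y : PosetRealization (PosetSd P)) : PosetRealization P :=
  ⟨⟨baryFun y.coord, fun p => baryFun_nonneg (fun c => y.1.2.1 c) p,
    (sum_baryFun _).trans y.1.2.2⟩, isChain_baryFun y.2⟩

theorem baryMap_bijective : Function.Bijective (baryMap (P := P)) := by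
  constructor
  · intro y z h
    refine PosetRealization.coord_injective (baryFun_injective (fun c => y.1.2.1 c)
      (fun c => z.1.2.1 c) y.2 z.2 ?_)
    exact congrArg PosetRealization.coord h
  · intro x
    obtain ⟨y, hy0, hyc, -, hyx⟩ := baryFun_surjective_aux _ x.coord (fun p => x.1.2.1 p) x.2 le_rfl
    refine ⟨⟨⟨y, hy0, ?_⟩, hyc⟩, PosetRealization.coord_injective hyx⟩
    rw [← sum_baryFun, hyx]
    exact x.1.2.2

theorem continuous_baryMap : Continuous (baryMap (P := P)) := by
  classical
  refine Continuous.subtype_mk (Continuous.subtype_mk (continuous_pi fun p => ?_) _) _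
  refine continuous_finsetSum _ fun c _ => ?_
  by_cases hpc : p ∈ c.finset
  · simp only [if_pos hpc]
    exact ((continuous_apply c).comp PosetRealization.continuous_coord).div_const _
  · simp only [if_neg hpc]
    exact continuous_const

end

/-- The canonical homeomorphism `|sd P| ≅ |P|`. -/
noncomputable def homeo (P : Type*) [Fintype P] [PartialOrder P] :
    PosetRealization (PosetSd P) ≃ₜ PosetRealization P :=
  Continuous.homeoOfEquivCompactToT2 (f := Equiv.ofBijective baryMap baryMap_bijective)
    continuous_baryMap

end PosetSd

/-! ## Equivariant homotopy inverses -/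

/-- A continuous map between `G`-spaces that commutes with the actions. -/
def IsEquivariantMap (G : Type*) {X Y : Type*} [TopologicalSpace X] [TopologicalSpace Y]
    [SMul G X] [SMul G Y] (f : C(X, Y)) : Prop :=
  ∀ (g : G) (x : X), f (g • x) = g • f x

/-- `f` and `g` are mutually inverse `G`-homotopy equivalences: both are equivariant and both
composites are homotopic to the identity through equivariant maps. -/
structure AreEquivariantHomotopyInverses (G : Type*) {X Y : Type*} [TopologicalSpace X]
    [TopologicalSpace Y] [SMul G X] [SMul G Y] (f : C(X, Y)) (g : C(Y, X)) : Prop where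
  equivariant_left : IsEquivariantMap G f
  equivariant_right : IsEquivariantMap G g
  homotopic_left : (g.comp f).HomotopicWith (ContinuousMap.id X) (IsEquivariantMap G)
  homotopic_right : (f.comp g).HomotopicWith (ContinuousMap.id Y) (IsEquivariantMap G)

/-! ## Double orders -/

/-- A strict partial order is semi-linear if it is induced by a surjection onto a finite linearly
ordered set `{1 < ... < l}`. -/
def IsSemiLinear {A : Type*} (r : A → A → Prop) : Prop :=
  ∃ (l : ℕ) (h : A → Fin l), Function.Surjective h ∧ ∀ a b, r a b ↔ h a < h b

/-- A double order: a pair of strict partial orders such that any two distinct elements are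
comparable by at least one of them. -/
@[ext]
structure DoubleOrder (A : Type*) where
  x : A → A → Prop
  y : A → A → Prop
  strict_x : IsStrictOrder A x
  strict_y : IsStrictOrder A y
  comparable : ∀ a b, a ≠ b → x a b ∨ x b a ∨ y a b ∨ y b a

namespace DoubleOrder

variable {A : Type*}

/-- Regular double orders. -/
def IsRegular (d : DoubleOrder A) : Prop :=
  IsSemiLinear d.x ∧ ∀ a b, d.x a b → ¬ d.y a b ∧ ¬ d.y b a

/-- Semi-regular double orders: the finite (nonempty) unions of regular ones, where the union of
strict partial orders is the transitive closure of the union of relations. -/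
def IsSemiRegular (d : DoubleOrder A) : Prop :=
  ∃ (k : ℕ) (e : Fin (k + 1) → DoubleOrder A), (∀ i, (e i).IsRegular) ∧
    d.x = Relation.TransGen (fun a b => ∃ i, (e i).x a b) ∧
    d.y = Relation.TransGen (fun a b => ∃ i, (e i).y a b)

/-- The relation `a (r \ s) b`: `a r b` and `a`, `b` are not comparable by `s`. -/
def relDiff (r s : A → A → Prop) (a b : A) : Prop := r a b ∧ ¬ s a b ∧ ¬ s b a

/-- The double order `d σ`, with `a (r σ) b ↔ σ a r σ b` for both relations. -/
def permute (d : DoubleOrder A) (σ : Equiv.Perm A) : DoubleOrder A where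
  x a b := d.x (σ a) (σ b)
  y a b := d.y (σ a) (σ b)
  strict_x :=
    { irrefl := fun a => d.strict_x.irrefl (σ a)
      trans := fun a b c => d.strict_x.trans (σ a) (σ b) (σ c) }
  strict_y :=
    { irrefl := fun a => d.strict_y.irrefl (σ a)
      trans := fun a b c => d.strict_y.trans (σ a) (σ b) (σ c) }
  comparable a b h := d.comparable (σ a) (σ b) (fun h' => h (σ.injective h'))

theorem permute_one (d : DoubleOrder A) : d.permute 1 = d := rfl

theorem permute_mul (d : DoubleOrder A) (σ τ : Equiv.Perm A) :
    d.permute (σ * τ) = (d.permute σ).permute τ := rfl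

theorem IsRegular.permute {d : DoubleOrder A} (hd : d.IsRegular) (σ : Equiv.Perm A) :
    (d.permute σ).IsRegular := by
  obtain ⟨⟨l, h, hs, hh⟩, hd2⟩ := hd
  exact ⟨⟨l, h ∘ σ, hs.comp σ.surjective, fun a b => hh (σ a) (σ b)⟩,
    fun a b => hd2 (σ a) (σ b)⟩

theorem transGen_permute (r : A → A → Prop) (σ : Equiv.Perm A) (a b : A) :
    Relation.TransGen r (σ a) (σ b) ↔ Relation.TransGen (fun a b => r (σ a) (σ b)) a b := by
  constructor
  · intro h
    have := Relation.TransGen.lift (p := fun a b => r (σ a) (σ b)) (σ.symm : A → A)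
      (fun a b hab => by simpa [Function.onFun] using hab) _ _ h
    simp only [Function.onFun, Equiv.symm_apply_apply] at this
    exact this
  · exact fun h => Relation.TransGen.lift (p := r) σ (fun _ _ hab => hab) _ _ h

theorem IsSemiRegular.permute {d : DoubleOrder A} (hd : d.IsSemiRegular) (σ : Equiv.Perm A) :
    (d.permute σ).IsSemiRegular := by
  obtain ⟨k, e, he, hx, hy⟩ := hd
  refine ⟨k, fun i => (e i).permute σ, fun i => (he i).permute σ, ?_, ?_⟩
  · funext a b
    change d.x (σ a) (σ b) = _
    rw [hx]
    exact propext (transGen_permute _ σ a b)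
  · funext a b
    change d.y (σ a) (σ b) = _
    rw [hy]
    exact propext (transGen_permute _ σ a b)

instance [Finite A] : Finite (DoubleOrder A) :=
  Finite.of_injective (fun d : DoubleOrder A => (d.x, d.y)) fun d e h => by
    simp only [Prod.mk.injEq] at h
    exact DoubleOrder.ext h.1 h.2

end DoubleOrder

/-- The set `R(A)` of regular double orders. -/
@[ext]
structure RegularDoubleOrder (A : Type*) extends DoubleOrder A where
  regular : toDoubleOrder.IsRegular

/-- The set `R⁺(A)` of semi-regular double orders. -/
@[ext]
structure SemiRegularDoubleOrder (A : Type*) extends DoubleOrder A where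
  semiRegular : toDoubleOrder.IsSemiRegular

namespace RegularDoubleOrder

variable {A : Type*}

theorem toDoubleOrder_injective :
    Function.Injective (toDoubleOrder : RegularDoubleOrder A → DoubleOrder A) :=
  fun _ _ h => RegularDoubleOrder.ext (congrArg DoubleOrder.x h) (congrArg DoubleOrder.y h)

/-- The order `⊑` on `R(A)`: `d ⊑ e` iff `d.x ⊆ e.x` and `d.y ⊇ e.y`. -/
instance : PartialOrder (RegularDoubleOrder A) where
  le d e := (∀ a b, d.x a b → e.x a b) ∧ ∀ a b, e.y a b → d.y a b
  le_refl _ := ⟨fun _ _ h => h, fun _ _ h => h⟩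
  le_trans _ _ _ h k := ⟨fun a b t => k.1 a b (h.1 a b t), fun a b t => h.2 a b (k.2 a b t)⟩
  le_antisymm _ _ h k := RegularDoubleOrder.ext
    (funext fun a => funext fun b => propext ⟨h.1 a b, k.1 a b⟩)
    (funext fun a => funext fun b => propext ⟨k.2 a b, h.2 a b⟩)

noncomputable instance [Finite A] : Fintype (RegularDoubleOrder A) :=
  @Fintype.ofFinite _ (Finite.of_injective _ toDoubleOrder_injective)

/-- The right action of the permutations of `A`, as a left action of the opposite group:
`op σ • d = d σ`. -/
instance : MulAction (Equiv.Perm A)ᵐᵒᵖ (RegularDoubleOrder A) where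
  smul σ d := ⟨d.toDoubleOrder.permute σ.unop, d.regular.permute σ.unop⟩
  one_smul _ := rfl
  mul_smul _ _ _ := rfl

instance : CovariantClass (Equiv.Perm A)ᵐᵒᵖ (RegularDoubleOrder A) (· • ·) (· ≤ ·) where
  elim σ _ _ h :=
    ⟨fun a b => h.1 (σ.unop a) (σ.unop b), fun a b => h.2 (σ.unop a) (σ.unop b)⟩

end RegularDoubleOrder

namespace SemiRegularDoubleOrder

variable {A : Type*}

theorem toDoubleOrder_injective :
    Function.Injective (toDoubleOrder : SemiRegularDoubleOrder A → DoubleOrder A) :=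
  fun _ _ h => SemiRegularDoubleOrder.ext (congrArg DoubleOrder.x h) (congrArg DoubleOrder.y h)

/-- The order `⊆` on `R⁺(A)`: `d ⊆ e` iff `d.x ⊆ e.x` and `d.y ⊆ e.y`. -/
instance : PartialOrder (SemiRegularDoubleOrder A) where
  le d e := (∀ a b, d.x a b → e.x a b) ∧ ∀ a b, d.y a b → e.y a b
  le_refl _ := ⟨fun _ _ h => h, fun _ _ h => h⟩
  le_trans _ _ _ h k := ⟨fun a b t => k.1 a b (h.1 a b t), fun a b t => k.2 a b (h.2 a b t)⟩
  le_antisymm _ _ h k := SemiRegularDoubleOrder.ext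
    (funext fun a => funext fun b => propext ⟨h.1 a b, k.1 a b⟩)
    (funext fun a => funext fun b => propext ⟨h.2 a b, k.2 a b⟩)

noncomputable instance [Finite A] : Fintype (SemiRegularDoubleOrder A) :=
  @Fintype.ofFinite _ (Finite.of_injective _ toDoubleOrder_injective)

/-- The right action of the permutations of `A`, as a left action of the opposite group:
`op σ • d = d σ`. -/
instance : MulAction (Equiv.Perm A)ᵐᵒᵖ (SemiRegularDoubleOrder A) where
  smul σ d := ⟨d.toDoubleOrder.permute σ.unop, d.semiRegular.permute σ.unop⟩
  one_smul _ := rfl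
  mul_smul _ _ _ := rfl

instance : CovariantClass (Equiv.Perm A)ᵐᵒᵖ (SemiRegularDoubleOrder A) (· • ·) (· ≤ ·) where
  elim σ _ _ h :=
    ⟨fun a b => h.1 (σ.unop a) (σ.unop b), fun a b => h.2 (σ.unop a) (σ.unop b)⟩

end SemiRegularDoubleOrder

namespace DoubleOrder

variable {A : Type*}

theorem negTrans_of_isSemiLinear {r : A → A → Prop} (h : IsSemiLinear r) {a c : A} (hac : r a c)
    (b : A) : r a b ∨ r b c := by
  obtain ⟨l, f, -, hf⟩ := h
  rw [hf] at hac
  rw [hf, hf]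
  exact (lt_or_ge (f a) (f b)).imp id (fun hba => lt_of_le_of_lt hba hac)

theorem isSemiLinear_of_negTrans [Finite A] {r : A → A → Prop} (hr : IsStrictOrder A r)
    (h : ∀ a b c, r a c → r a b ∨ r b c) : IsSemiLinear r := by
  classical
  have := Fintype.ofFinite A
  let f : A → ℕ := fun a => (Finset.univ.filter fun b => r b a).card
  have hlt : ∀ a b, r a b → f a < f b := by
    intro a b hab
    refine Finset.card_lt_card ⟨fun c hc => ?_, fun hss => ?_⟩
    · simp only [Finset.mem_filter_univ] at hc ⊢
      exact hr.trans c a b hc hab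
    · have : a ∈ Finset.univ.filter fun c => r c a := hss (by simpa using hab)
      exact hr.irrefl a (by simpa using this)
  have hle : ∀ a b, ¬ r a b → f b ≤ f a := by
    intro a b hab
    refine Finset.card_le_card fun c hc => ?_
    simp only [Finset.mem_filter_univ] at hc ⊢
    exact (h c a b hc).resolve_right hab
  have hiff : ∀ a b, r a b ↔ f a < f b := fun a b =>
    ⟨hlt a b, fun hab => by_contra fun hn => absurd (hle a b hn) (not_le.mpr hab)⟩
  let T : Finset ℕ := Finset.univ.image f
  let e := T.orderIsoOfFin rfl
  refine ⟨T.card, fun a => e.symm ⟨f a, Finset.mem_image_of_mem f (Finset.mem_univ a)⟩, ?_, ?_⟩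
  · intro i
    obtain ⟨a, -, ha⟩ := Finset.mem_image.mp (e i).2
    refine ⟨a, ?_⟩
    rw [OrderIso.symm_apply_eq]
    exact Subtype.ext ha
  · intro a b
    rw [hiff, e.symm.lt_iff_lt]
    exact Iff.rfl

theorem IsSemiRegular.isSemiLinear_x [Finite A] {d : DoubleOrder A} (hd : d.IsSemiRegular) :
    IsSemiLinear d.x := by
  refine isSemiLinear_of_negTrans d.strict_x ?_
  obtain ⟨k, e, he, hx, -⟩ := hd
  rw [hx]
  intro a b c hac
  induction hac with
  | single h =>
    obtain ⟨i, hi⟩ := h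
    exact (negTrans_of_isSemiLinear (he i).1 hi b).imp (fun t => .single ⟨i, t⟩) (fun t => .single ⟨i, t⟩)
  | tail _ h ih =>
    rcases ih with h1 | h1
    · exact Or.inl h1
    · exact Or.inr (h1.tail h)

/-- The double order `(x, y \ x)`, for `x` semi-linear. -/
def reduce (d : DoubleOrder A) (hd : IsSemiLinear d.x) : DoubleOrder A where
  x := d.x
  y := relDiff d.y d.x
  strict_x := d.strict_x
  strict_y :=
    { irrefl := fun a h => d.strict_y.irrefl a h.1
      trans := fun a b c hab hbc =>
        ⟨d.strict_y.trans a b c hab.1 hbc.1,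
          fun h => (negTrans_of_isSemiLinear hd h b).elim hab.2.1 hbc.2.1,
          fun h => (negTrans_of_isSemiLinear hd h b).elim hbc.2.2 hab.2.2⟩ }
  comparable a b hab := by
    by_cases h1 : d.x a b
    · exact Or.inl h1
    by_cases h2 : d.x b a
    · exact Or.inr (Or.inl h2)
    rcases d.comparable a b hab with h | h | h | h
    · exact absurd h h1
    · exact absurd h h2
    · exact Or.inr (Or.inr (Or.inl ⟨h, h1, h2⟩))
    · exact Or.inr (Or.inr (Or.inr ⟨h, h2, h1⟩))

/-- The order-preserving map `F : (R⁺(A), ⊆) → (R(A), ⊑)`, `(x, y) ↦ (x, y \ x)`. -/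
def mapF (A : Type*) [Finite A] : SemiRegularDoubleOrder A →o RegularDoubleOrder A where
  toFun d := ⟨d.toDoubleOrder.reduce d.semiRegular.isSemiLinear_x,
    d.semiRegular.isSemiLinear_x, fun _ _ hx => ⟨fun h => h.2.1 hx, fun h => h.2.2 hx⟩⟩
  monotone' := by
    intro d e hde
    refine ⟨hde.1, ?_⟩
    rintro a b ⟨hy, hx1, hx2⟩
    have n1 : ¬ d.x a b := fun h => hx1 (hde.1 a b h)
    have n2 : ¬ d.x b a := fun h => hx2 (hde.1 b a h)
    have hab : a ≠ b := by
      rintro rfl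
      exact e.strict_y.irrefl a hy
    refine ⟨?_, n1, n2⟩
    rcases d.comparable a b hab with h | h | h | h
    · exact absurd h n1
    · exact absurd h n2
    · exact h
    · exact absurd (e.strict_y.trans a b a hy (hde.2 b a h)) (e.strict_y.irrefl a)

/-- The union of the double orders of a chain in `(R(A), ⊑)`. -/
def chainUnion (c : PosetSd (RegularDoubleOrder A)) : DoubleOrder A where
  x a b := ∃ d ∈ c.finset, d.x a b
  y a b := ∃ d ∈ c.finset, d.y a b
  strict_x :=
    { irrefl := fun a ⟨d, _, h⟩ => d.strict_x.irrefl a h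
      trans := by
        rintro p q r ⟨d, hd, h⟩ ⟨e, he, k⟩
        rcases c.comparable ⟨d, hd⟩ ⟨e, he⟩ with t | t
        · exact ⟨e, he, e.strict_x.trans p q r (t.1 p q h) k⟩
        · exact ⟨d, hd, d.strict_x.trans p q r h (t.1 q r k)⟩ }
  strict_y :=
    { irrefl := fun a ⟨d, _, h⟩ => d.strict_y.irrefl a h
      trans := by
        rintro p q r ⟨d, hd, h⟩ ⟨e, he, k⟩
        rcases c.comparable ⟨d, hd⟩ ⟨e, he⟩ with t | t
        · exact ⟨d, hd, d.strict_y.trans p q r h (t.2 q r k)⟩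
        · exact ⟨e, he, e.strict_y.trans p q r (t.2 p q h) k⟩ }
  comparable a b hab := by
    obtain ⟨d, hd⟩ := c.nonempty
    exact (d.comparable a b hab).imp (fun h => ⟨d, hd, h⟩) (Or.imp (fun h => ⟨d, hd, h⟩)
      (Or.imp (fun h => ⟨d, hd, h⟩) (fun h => ⟨d, hd, h⟩)))

theorem transGen_of_isStrictOrder {r : A → A → Prop} (hr : IsStrictOrder A r) :
    Relation.TransGen r = r :=
  have := hr.toIsTrans
  Relation.transGen_eq_self

theorem chainUnion_isSemiRegular (c : PosetSd (RegularDoubleOrder A)) :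
    (chainUnion c).IsSemiRegular := by
  have hpos : c.finset.card - 1 + 1 = c.finset.card :=
    Nat.sub_add_cancel c.nonempty.card_pos
  let φ : Fin (c.finset.card - 1 + 1) ≃ c.finset := (finCongr hpos).trans c.finset.equivFin.symm
  refine ⟨c.finset.card - 1, fun i => (φ i).1.toDoubleOrder, fun i => (φ i).1.regular, ?_, ?_⟩
  · have h : (fun a b => ∃ i, (φ i).1.x a b) = (chainUnion c).x := by
      funext a b
      refine propext ⟨fun ⟨i, hi⟩ => ⟨(φ i).1, (φ i).2, hi⟩, fun ⟨d, hd, hi⟩ => ?_⟩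
      exact ⟨φ.symm ⟨d, hd⟩, by simpa using hi⟩
    rw [h, transGen_of_isStrictOrder (chainUnion c).strict_x]
  · have h : (fun a b => ∃ i, (φ i).1.y a b) = (chainUnion c).y := by
      funext a b
      refine propext ⟨fun ⟨i, hi⟩ => ⟨(φ i).1, (φ i).2, hi⟩, fun ⟨d, hd, hi⟩ => ?_⟩
      exact ⟨φ.symm ⟨d, hd⟩, by simpa using hi⟩
    rw [h, transGen_of_isStrictOrder (chainUnion c).strict_y]

/-- The order-preserving map `G : sd (R(A), ⊑) → (R⁺(A), ⊆)`, sending a chain `d₀ ⊏ ... ⊏ d_r` to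
the union of its members, i.e. to `(x_r, y_0)`. -/
def mapG (A : Type*) : PosetSd (RegularDoubleOrder A) →o SemiRegularDoubleOrder A where
  toFun c := ⟨chainUnion c, chainUnion_isSemiRegular c⟩
  monotone' _ _ h := ⟨fun _ _ ⟨d, hd, k⟩ => ⟨d, h hd, k⟩, fun _ _ ⟨d, hd, k⟩ => ⟨d, h hd, k⟩⟩

/-- On a chain with greatest element `t` and least element `s`, `G` has the value `(t.x, s.y)`. -/
theorem mapG_eq (c : PosetSd (RegularDoubleOrder A)) {s t : RegularDoubleOrder A}
    (hs : s ∈ c.finset) (ht : t ∈ c.finset) (hsc : ∀ d ∈ c.finset, s ≤ d)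
    (htc : ∀ d ∈ c.finset, d ≤ t) : (mapG A c).x = t.x ∧ (mapG A c).y = s.y :=
  ⟨funext fun a => funext fun b =>
      propext ⟨fun ⟨d, hd, h⟩ => (htc d hd).1 a b h, fun h => ⟨t, ht, h⟩⟩,
    funext fun a => funext fun b =>
      propext ⟨fun ⟨d, hd, h⟩ => (hsc d hd).2 a b h, fun h => ⟨s, hs, h⟩⟩⟩

/-- The realized map `|F| : |(R⁺(A), ⊆)| → |(R(A), ⊑)|`. -/
noncomputable def realF (A : Type*) [Finite A] :
    C(PosetRealization (SemiRegularDoubleOrder A), PosetRealization (RegularDoubleOrder A)) :=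
  PosetRealization.map (mapF A)

/-- The composite `|(R(A), ⊑)| ≅ |sd (R(A), ⊑)| → |(R⁺(A), ⊆)|` of the inverse of the canonical
homeomorphism and `|G|`. -/
noncomputable def realG (A : Type*) [Finite A] :
    C(PosetRealization (RegularDoubleOrder A), PosetRealization (SemiRegularDoubleOrder A)) :=
  (PosetRealization.map (mapG A)).comp
    ((PosetSd.homeo (RegularDoubleOrder A)).symm :
      C(PosetRealization (RegularDoubleOrder A),
        PosetRealization (PosetSd (RegularDoubleOrder A))))

end DoubleOrder

/-! ## Coordinates of points of realizations -/

namespace PosetRealization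

/-! Both composites are compared with last vertex maps `sd P → P`, which send a chain to its
greatest element. Let a chain in `(R(A), ⊑)` have least element `s` and greatest element `t`. Then
`G` gives `(t.x, s.y)`, and removing from `s.y` the pairs comparable by `t.x` leaves exactly `t.y`.
So `F ∘ G` equals the last vertex map (`mapF_comp_mapG`). In the other direction `F d` is contained
in `d` componentwise, hence `G ∘ sd F` is only bounded above by the last vertex map of `sd R⁺(A)`
(`mapG_comp_sd_mapF_le`).

Three homotopies turn this into topology. The last vertex map is homotopic to the canonical
homeomorphism `|sd P| ≅ |P|`, and that homeomorphism is natural up to homotopy; in both cases the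
two maps carry each point into a common simplex, so segments suffice. Comparable order-preserving
maps `f ≤ g` have homotopic realizations (`prism`): the mass of a point is moved from `f` to `g`
starting at the top of its supporting chain. No homotopy involves a choice, so all of them commute
with the group action. Since the canonical homeomorphism is equivariant, both claims may be checked
after precomposing with it. -/

theorem smulHom_apply {G P : Type*} [Group G] [PartialOrder P] [MulAction G P]
    [CovariantClass G P (· • ·) (· ≤ ·)] (g : G) (p : P) : (smulHom g : P →o P) p = g • p :=
  rfl

variable {P Q R : Type*} [Fintype P] [PartialOrder P] [Fintype Q] [PartialOrder Q]
  [Fintype R] [PartialOrder R]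

theorem coord_nonneg (x : PosetRealization P) (p : P) : 0 ≤ x.coord p :=
  x.1.2.1 p

theorem sum_coord (x : PosetRealization P) : ∑ p, x.coord p = 1 :=
  x.1.2.2

theorem isChain_coord (x : PosetRealization P) : IsChain (· ≤ ·) {p | x.coord p ≠ 0} :=
  x.2

theorem continuous_coord_apply (p : P) : Continuous fun x : PosetRealization P => x.coord p :=
  (continuous_apply p).comp continuous_coord

/-- The point of `|P|` with given barycentric coordinates. -/
def ofCoord (w : P → ℝ) (h0 : ∀ p, 0 ≤ w p) (h1 : ∑ p, w p = 1)
    (hw : IsChain (· ≤ ·) {p | w p ≠ 0}) : PosetRealization P :=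
  ⟨⟨w, h0, h1⟩, hw⟩

@[simp]
theorem coord_ofCoord (w : P → ℝ) (h0 : ∀ p, 0 ≤ w p) (h1 : ∑ p, w p = 1)
    (hw : IsChain (· ≤ ·) {p | w p ≠ 0}) : (ofCoord w h0 h1 hw).coord = w :=
  rfl

theorem continuous_iff_coord {X : Type*} [TopologicalSpace X] {f : X → PosetRealization P} :
    Continuous f ↔ ∀ p, Continuous fun x => (f x).coord p := by
  refine ⟨fun h p => (continuous_coord_apply p).comp h, fun h => ?_⟩
  exact Continuous.subtype_mk (Continuous.subtype_mk (continuous_pi h) _) _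

open scoped Classical in
theorem coord_map (f : P →o Q) (x : PosetRealization P) (q : Q) :
    (map f x).coord q = ∑ p, if f p = q then x.coord p else 0 := by
  rw [← Finset.sum_filter]
  exact FunOnFinite.linearMap_apply_apply ℝ ℝ f (fun p => x.coord p) q

theorem exists_of_coord_map_ne_zero {f : P →o Q} {x : PosetRealization P} {q : Q}
    (h : (map f x).coord q ≠ 0) : ∃ p, x.coord p ≠ 0 ∧ f p = q := by
  classical
  rw [coord_map] at h
  obtain ⟨p, -, hp⟩ := Finset.exists_ne_zero_of_sum_ne_zero h
  by_cases hq : f p = q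
  · exact ⟨p, by simpa [hq] using hp, hq⟩
  · simp [hq] at hp

theorem map_comp (f : P →o Q) (g : Q →o R) :
    (map g).comp (map f) = map (g.comp f) :=
  ContinuousMap.ext fun x => Subtype.ext (stdSimplex.map_comp_apply f g x.1)

/-! ### Group actions on realizations -/

section Action

variable {G : Type*} [Group G] [MulAction G P] [CovariantClass G P (· • ·) (· ≤ ·)]
  [MulAction G Q] [CovariantClass G Q (· • ·) (· ≤ ·)]

theorem smul_eq_map (g : G) (x : PosetRealization P) : g • x = map (smulHom g) x :=
  rfl

theorem coord_smul (g : G) (x : PosetRealization P) (p : P) :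
    (g • x).coord p = x.coord (g⁻¹ • p) := by
  classical
  rw [smul_eq_map, coord_map]
  have h : ∀ q, (smulHom g : P →o P) q = p ↔ q = g⁻¹ • p := fun q => by
    rw [eq_inv_smul_iff]; rfl
  simp [h]

theorem isEquivariantMap_map {f : P →o Q} (hf : ∀ (g : G) (p : P), f (g • p) = g • f p) :
    IsEquivariantMap G (map f) := by
  intro g x
  rw [smul_eq_map, smul_eq_map, ← ContinuousMap.comp_apply, ← ContinuousMap.comp_apply,
    map_comp, map_comp]
  congr 2
  exact OrderHom.ext _ _ (funext fun p => hf g p)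

end Action

/-! ## Homotopies between maps into a realization -/

/-- The straight-line homotopy between two maps that carry every point into a common simplex. -/
def straightLine {X : Type*} [TopologicalSpace X] (f₀ f₁ : C(X, PosetRealization Q))
    (h : ∀ x, IsChain (· ≤ ·) {q | (f₀ x).coord q ≠ 0 ∨ (f₁ x).coord q ≠ 0}) :
    f₀.Homotopy f₁ where
  toFun z := ofCoord
    (fun q => (1 - (z.1 : ℝ)) * (f₀ z.2).coord q + (z.1 : ℝ) * (f₁ z.2).coord q)
    (fun q => add_nonneg (mul_nonneg (sub_nonneg.2 z.1.2.2) (coord_nonneg _ _))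
      (mul_nonneg z.1.2.1 (coord_nonneg _ _)))
    (by
      rw [Finset.sum_add_distrib, ← Finset.mul_sum, ← Finset.mul_sum, sum_coord, sum_coord]
      ring)
    ((h z.2).mono fun q hq => by
      by_contra hn
      simp only [Set.mem_ofPred_eq, not_or, not_not] at hn
      exact hq (by simp [hn.1, hn.2]))
  continuous_toFun := by
    refine continuous_iff_coord.2 fun q => ?_
    have h₀ := (continuous_coord_apply q).comp (f₀.continuous.comp
      (continuous_snd (X := unitInterval)))
    have h₁ := (continuous_coord_apply q).comp (f₁.continuous.comp
      (continuous_snd (X := unitInterval)))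
    have ht : Continuous fun z : unitInterval × X => (z.1 : ℝ) :=
      continuous_subtype_val.comp continuous_fst
    exact ((continuous_const.sub ht).mul h₀).add (ht.mul h₁)
  map_zero_left x := coord_injective (funext fun q => by simp)
  map_one_left x := coord_injective (funext fun q => by simp)

/-- A group element acts on barycentric coordinates by permuting them, so it commutes with convex
combinations: segments between equivariant maps are automatically equivariant. -/
theorem homotopicWith_of_isChain {G X : Type*} [Group G] [TopologicalSpace X] [SMul G X]
    [MulAction G Q] [CovariantClass G Q (· • ·) (· ≤ ·)]
    {f₀ f₁ : C(X, PosetRealization Q)} (hf₀ : IsEquivariantMap G f₀)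
    (hf₁ : IsEquivariantMap G f₁)
    (h : ∀ x, IsChain (· ≤ ·) {q | (f₀ x).coord q ≠ 0 ∨ (f₁ x).coord q ≠ 0}) :
    f₀.HomotopicWith f₁ (IsEquivariantMap G) := by
  refine ⟨⟨straightLine f₀ f₁ h, fun t g x => coord_injective (funext fun q => ?_)⟩⟩
  rw [coord_smul]
  change (1 - (t : ℝ)) * (f₀ (g • x)).coord q + (t : ℝ) * (f₁ (g • x)).coord q =
    (1 - (t : ℝ)) * (f₀ x).coord (g⁻¹ • q) + (t : ℝ) * (f₁ x).coord (g⁻¹ • q)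
  rw [hf₀, hf₁, coord_smul, coord_smul]

open scoped Classical in
/-- The part of the mass of `x` at `p` that lies in the upper part of `x` of total mass `t`. -/
noncomputable def upperMass (t : ℝ) (x : PosetRealization P) (p : P) : ℝ :=
  max 0 (min (x.coord p) (t - ∑ q, if p < q then x.coord q else 0))

theorem upperMass_nonneg (t : ℝ) (x : PosetRealization P) (p : P) : 0 ≤ upperMass t x p :=
  le_max_left _ _

theorem upperMass_le (t : ℝ) (x : PosetRealization P) (p : P) : upperMass t x p ≤ x.coord p :=
  max_le (coord_nonneg x p) (min_le_left _ _)

theorem continuous_upperMass (p : P) :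
    Continuous fun z : unitInterval × PosetRealization P => upperMass (z.1 : ℝ) z.2 p := by
  classical
  have hc : ∀ q, Continuous fun z : unitInterval × PosetRealization P => z.2.coord q :=
    fun q => (continuous_coord_apply q).comp continuous_snd
  refine continuous_const.max ((hc p).min ((continuous_subtype_val.comp continuous_fst).sub
    (continuous_finsetSum _ fun q _ => ?_)))
  by_cases h : p < q
  · simpa [h] using hc q
  · simpa [h] using continuous_const

theorem upperMass_zero (x : PosetRealization P) (p : P) : upperMass 0 x p = 0 := by
  classical
  refine max_eq_left ((min_le_right _ _).trans ?_)
  rw [zero_sub, neg_nonpos]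
  exact Finset.sum_nonneg fun q _ => by split_ifs <;> simp [coord_nonneg]

open scoped Classical in
theorem coord_add_sum_lt_le (x : PosetRealization P) (p : P) :
    x.coord p + (∑ q, if p < q then x.coord q else 0) = ∑ q, if p ≤ q then x.coord q else 0 := by
  have h : ∀ q, (if p ≤ q then x.coord q else 0) =
      (if p = q then x.coord q else 0) + if p < q then x.coord q else 0 := by
    intro q
    by_cases h1 : p = q
    · simp [h1]
    · simp [h1, lt_iff_le_and_ne]
  simp [h, Finset.sum_add_distrib]

/-- The mass at and above `p` is at most the total mass 1, so at time 1 the bound inside the minimum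
never cuts anything off. -/
theorem upperMass_one (x : PosetRealization P) (p : P) : upperMass 1 x p = x.coord p := by
  classical
  have h : (∑ q, if p ≤ q then x.coord q else 0) ≤ 1 := by
    rw [← sum_coord x]
    exact Finset.sum_le_sum fun q _ => by split_ifs <;> simp [coord_nonneg]
  rw [upperMass, min_eq_left (by linarith [coord_add_sum_lt_le x p]),
    max_eq_right (coord_nonneg x p)]

/-- The mass is taken from the top down: if anything is taken at `p`, then `t` exceeds the mass
strictly above `p`, which includes all mass at and above `q`, so `q` has been taken completely.
Hence at most one element of the support is split. -/
theorem upperMass_eq_of_lt {t : ℝ} {x : PosetRealization P} {p q : P} (hpq : p < q)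
    (hp : upperMass t x p ≠ 0) : upperMass t x q = x.coord q := by
  classical
  have h1 : (∑ r, if q ≤ r then x.coord r else 0) ≤ ∑ r, if p < r then x.coord r else 0 := by
    refine Finset.sum_le_sum fun r _ => ?_
    by_cases hr : q ≤ r
    · simp [hr, hpq.trans_le hr]
    · simp only [hr, if_false]
      split_ifs <;> simp [coord_nonneg]
  have h2 : 0 < t - ∑ r, if p < r then x.coord r else 0 := by
    by_contra hn
    exact hp (max_eq_left ((min_le_right _ _).trans (not_lt.1 hn)))
  rw [upperMass, min_eq_left (by linarith [coord_add_sum_lt_le x q]),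
    max_eq_right (coord_nonneg x q)]

theorem upperMass_smul {G : Type*} [Group G] [MulAction G P]
    [CovariantClass G P (· • ·) (· ≤ ·)] (t : ℝ) (g : G) (x : PosetRealization P) (p : P) :
    upperMass t (g • x) (g • p) = upperMass t x p := by
  classical
  have hle : ∀ (k : G) {a b : P}, a ≤ b → k • a ≤ k • b := fun k _ _ h => CovariantClass.elim k h
  -- Only monotonicity of the action is assumed; applying it to `g⁻¹` as well makes each translation
  -- an order automorphism.
  have hlt : ∀ q, g • p < g • q ↔ p < q := by
    intro q
    have : ∀ a b : P, g • a ≤ g • b ↔ a ≤ b := fun a b =>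
      ⟨fun h => by simpa using hle g⁻¹ h, hle g⟩
    rw [lt_iff_le_not_ge, lt_iff_le_not_ge, this, this]
  have hs : (∑ q, if g • p < q then (g • x).coord q else 0) =
      ∑ q, if p < q then x.coord q else 0 := by
    refine (Equiv.sum_comp (MulAction.toPerm g) _).symm.trans ?_
    simp [hlt, coord_smul]
  rw [upperMass, upperMass, hs, coord_smul, inv_smul_smul]

open scoped Classical in
/-- The coordinates of the homotopy from `|f|` to `|g|`: at time `t`, the upper part of mass `t` is
moved by `g`, and the rest by `f`. -/
noncomputable def prismCoord (f g : P →o Q) (t : ℝ) (x : PosetRealization P) (q : Q) : ℝ :=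
  (∑ p, if f p = q then x.coord p - upperMass t x p else 0) +
    ∑ p, if g p = q then upperMass t x p else 0

theorem prismCoord_nonneg {Q : Type*} [PartialOrder Q] (f g : P →o Q) (t : ℝ)
    (x : PosetRealization P) (q : Q) :
    0 ≤ prismCoord f g t x q := by
  refine add_nonneg (Finset.sum_nonneg fun p _ => ?_) (Finset.sum_nonneg fun p _ => ?_)
  · split_ifs
    exacts [sub_nonneg.2 (upperMass_le t x p), le_rfl]
  · split_ifs
    exacts [upperMass_nonneg t x p, le_rfl]

theorem sum_prismCoord (f g : P →o Q) (t : ℝ) (x : PosetRealization P) :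
    ∑ q, prismCoord f g t x q = 1 := by
  classical
  unfold prismCoord
  rw [Finset.sum_add_distrib, Finset.sum_comm, Finset.sum_comm (γ := Q) (f := fun q p =>
    if g p = q then upperMass t x p else 0)]
  simp [sum_coord]

/-- The witness is also placed in the support of `x`, so that any two such witnesses are comparable.
-/
theorem exists_of_prismCoord_ne_zero {Q : Type*} [PartialOrder Q] {f g : P →o Q} {t : ℝ}
    {x : PosetRealization P} {q : Q} (h : prismCoord f g t x q ≠ 0) :
    (∃ p, f p = q ∧ upperMass t x p ≠ x.coord p ∧ x.coord p ≠ 0) ∨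
      ∃ p, g p = q ∧ upperMass t x p ≠ 0 ∧ x.coord p ≠ 0 := by
  classical
  have hx : ∀ p, x.coord p = 0 → upperMass t x p = 0 := fun p hp =>
    le_antisymm (hp ▸ upperMass_le t x p) (upperMass_nonneg t x p)
  by_contra! hn
  refine h ?_
  rw [prismCoord, Finset.sum_eq_zero, Finset.sum_eq_zero, add_zero]
  · intro p _
    by_cases hp : g p = q
    · rw [if_pos hp]
      by_contra h0
      exact h0 (hx p (hn.2 p hp h0))
    · exact if_neg hp
  · intro p _
    by_cases hp : f p = q
    · rw [if_pos hp]
      by_cases h0 : upperMass t x p = x.coord p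
      · rw [h0, sub_self]
      · have := hn.1 p hp h0
        rw [this, hx p this, sub_self]
    · exact if_neg hp

/-- A straight-line homotopy would fail here: for `p < q` in the support, `g p` and `f q` need not
be comparable. Moving the mass from the top down prevents them from occurring together, because
every element still moved by `f` lies below or at every element already moved by `g`. -/
theorem isChain_prismCoord {Q : Type*} [PartialOrder Q] {f g : P →o Q} (hfg : f ≤ g) (t : ℝ)
    (x : PosetRealization P) :
    IsChain (· ≤ ·) {q | prismCoord f g t x q ≠ 0} := by
  have key : ∀ p q, upperMass t x p ≠ x.coord p → x.coord p ≠ 0 → upperMass t x q ≠ 0 →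
      x.coord q ≠ 0 → f p ≤ g q := by
    intro p q hp hp0 hq hq0
    have hpq : p ≤ q := by
      rcases x.isChain_coord.total hp0 hq0 with h | h
      · exact h
      -- Equality is the case of the single split element. If `q < p`, then mass taken at `q` forces
      -- `p` to be taken completely, against `hp`.
      · rcases h.eq_or_lt with h | h
        · exact h.ge
        · exact absurd (upperMass_eq_of_lt h hq) hp
    exact (hfg p).trans (g.monotone hpq)
  intro a ha b hb _
  rcases exists_of_prismCoord_ne_zero ha with ⟨p, rfl, hp, hp0⟩ | ⟨p, rfl, hp, hp0⟩ <;>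
  rcases exists_of_prismCoord_ne_zero hb with ⟨q, rfl, hq, hq0⟩ | ⟨q, rfl, hq, hq0⟩
  · exact (x.isChain_coord.total hp0 hq0).imp (fun h => f.monotone h) (fun h => f.monotone h)
  · exact Or.inl (key p q hp hp0 hq hq0)
  · exact Or.inr (key q p hq hq0 hp hp0)
  · exact (x.isChain_coord.total hp0 hq0).imp (fun h => g.monotone h) (fun h => g.monotone h)

/-- The homotopy between the realizations of two comparable order-preserving maps. -/
noncomputable def prism {f g : P →o Q} (hfg : f ≤ g) : (map f).Homotopy (map g) where
  toFun z := ofCoord (prismCoord f g z.1 z.2) (prismCoord_nonneg f g _ _)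
    (sum_prismCoord f g _ _) (isChain_prismCoord hfg _ _)
  continuous_toFun := by
    classical
    refine continuous_iff_coord.2 fun q => ?_
    refine (continuous_finsetSum _ fun p _ => ?_).add (continuous_finsetSum _ fun p _ => ?_)
    · by_cases hp : f p = q
      · simp only [hp, if_true]
        exact ((continuous_coord_apply p).comp continuous_snd).sub (continuous_upperMass p)
      · simpa only [hp, if_false] using continuous_const
    · by_cases hp : g p = q
      · simpa only [hp, if_true] using continuous_upperMass p
      · simpa only [hp, if_false] using continuous_const
  map_zero_left x := coord_injective (funext fun q => by
    simp [prismCoord, upperMass_zero, coord_map])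
  map_one_left x := coord_injective (funext fun q => by
    simp [prismCoord, upperMass_one, coord_map])

/-- The upper part of a point is determined by the order and the coordinates alone, so the prism is
equivariant. -/
theorem homotopicWith_of_le {G : Type*} [Group G] [MulAction G P]
    [CovariantClass G P (· • ·) (· ≤ ·)] [MulAction G Q] [CovariantClass G Q (· • ·) (· ≤ ·)]
    {f₀ f₁ : P →o Q} (hf₀ : ∀ (g : G) (p : P), f₀ (g • p) = g • f₀ p)
    (hf₁ : ∀ (g : G) (p : P), f₁ (g • p) = g • f₁ p) (h : f₀ ≤ f₁) :
    (map f₀).HomotopicWith (map f₁) (IsEquivariantMap G) := by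
  classical
  refine ⟨⟨prism h, fun t g x => coord_injective (funext fun q => ?_)⟩⟩
  rw [coord_smul]
  change prismCoord f₀ f₁ t (g • x) q = prismCoord f₀ f₁ t x (g⁻¹ • q)
  unfold prismCoord
  -- Both sums are reindexed along the permutation `p ↦ g • p`.
  congr 1 <;> refine (Equiv.sum_comp (MulAction.toPerm g) _).symm.trans ?_
  · simp [upperMass_smul, coord_smul, hf₀, eq_inv_smul_iff]
  · simp [upperMass_smul, hf₁, eq_inv_smul_iff]

end PosetRealization

/-! ## Equivariant maps -/

section Equivariant

variable {G X Y Z : Type*} [TopologicalSpace X] [TopologicalSpace Y] [TopologicalSpace Z]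
  [SMul G X] [SMul G Y] [SMul G Z]

theorem IsEquivariantMap.comp {f : C(X, Y)} {k : C(Y, Z)} (hk : IsEquivariantMap G k)
    (hf : IsEquivariantMap G f) : IsEquivariantMap G (k.comp f) := fun g x => by
  rw [ContinuousMap.comp_apply, hf, hk, ContinuousMap.comp_apply]

theorem IsEquivariantMap.homeomorph_symm {e : X ≃ₜ Y} (he : IsEquivariantMap G (e : C(X, Y))) :
    IsEquivariantMap G (e.symm : C(Y, X)) := fun g y => by
  refine e.injective ?_
  have h := he g (e.symm y)
  simp only [ContinuousMap.coe_coe, Homeomorph.apply_symm_apply] at h ⊢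
  exact h.symm

theorem ContinuousMap.HomotopicWith.postcomp_equivariant {f₀ f₁ : C(X, Y)}
    (h : f₀.HomotopicWith f₁ (IsEquivariantMap G)) {k : C(Y, Z)} (hk : IsEquivariantMap G k) :
    (k.comp f₀).HomotopicWith (k.comp f₁) (IsEquivariantMap G) := by
  obtain ⟨H⟩ := h
  exact ⟨⟨
    { toFun := fun z => k (H z)
      continuous_toFun := by fun_prop
      map_zero_left := fun x => by simp
      map_one_left := fun x => by simp },
    fun t => hk.comp (H.prop' t)⟩⟩

theorem ContinuousMap.HomotopicWith.precomp_equivariant {f₀ f₁ : C(Y, Z)}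
    (h : f₀.HomotopicWith f₁ (IsEquivariantMap G)) {j : C(X, Y)} (hj : IsEquivariantMap G j) :
    (f₀.comp j).HomotopicWith (f₁.comp j) (IsEquivariantMap G) := by
  obtain ⟨H⟩ := h
  exact ⟨⟨
    { toFun := fun z => H (z.1, j z.2)
      continuous_toFun := by fun_prop
      map_zero_left := fun x => by simp
      map_one_left := fun x => by simp },
    fun t => IsEquivariantMap.comp (H.prop' t) hj⟩⟩

/-- This lets homotopies out of `|P|` be checked on `|sd P|`, where the last vertex map is
available. -/
theorem ContinuousMap.HomotopicWith.of_comp_homeomorph {e : X ≃ₜ Y}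
    (he : IsEquivariantMap G (e : C(X, Y))) {f₀ f₁ : C(Y, Z)}
    (h : (f₀.comp (e : C(X, Y))).HomotopicWith (f₁.comp (e : C(X, Y))) (IsEquivariantMap G)) :
    f₀.HomotopicWith f₁ (IsEquivariantMap G) := by
  have hf : ∀ f : C(Y, Z), (f.comp (e : C(X, Y))).comp (e.symm : C(Y, X)) = f := fun f => by
    ext y
    simp
  have := h.precomp_equivariant he.homeomorph_symm
  rwa [hf, hf] at this

end Equivariant

/-! ## Maps out of the barycentric subdivision -/

namespace PosetSd

open PosetRealization PartialOrder.NonemptyFiniteChains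

/-! ### Last vertices and group actions on chains -/

section

variable {P Q : Type*} [PartialOrder P] [PartialOrder Q]

theorem exists_greatest (c : PosetSd P) : ∃ t ∈ c.finset, ∀ d ∈ c.finset, d ≤ t := by
  obtain ⟨t, ht, hmax⟩ := c.finset.exists_maximal c.nonempty
  exact ⟨t, ht, fun d hd => (c.comparable ⟨d, hd⟩ ⟨t, ht⟩).elim id fun h => hmax hd h⟩

theorem exists_least (c : PosetSd P) : ∃ s ∈ c.finset, ∀ d ∈ c.finset, s ≤ d := by
  obtain ⟨s, hs, hmin⟩ := c.finset.exists_minimal c.nonempty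
  exact ⟨s, hs, fun d hd => (c.comparable ⟨s, hs⟩ ⟨d, hd⟩).elim id fun h => hmin hd h⟩

/-- The greatest element of a chain, as an order-preserving map. -/
noncomputable def last (P : Type*) [PartialOrder P] : PosetSd P →o P where
  toFun c := (exists_greatest c).choose
  monotone' c d h :=
    (exists_greatest d).choose_spec.2 _ (h (exists_greatest c).choose_spec.1)

theorem last_mem (c : PosetSd P) : last P c ∈ c.finset :=
  (exists_greatest c).choose_spec.1

theorem le_last {c : PosetSd P} {p : P} (hp : p ∈ c.finset) : p ≤ last P c :=
  (exists_greatest c).choose_spec.2 p hp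

/-- The action of a group on the chains of a poset on which it acts by order automorphisms. -/
noncomputable instance {G : Type*} [Group G] [MulAction G P]
    [CovariantClass G P (· • ·) (· ≤ ·)] : MulAction G (PosetSd P) where
  smul g c := c.map (smulHom g)
  one_smul c := by
    refine PartialOrder.NonemptyFiniteChains.ext (Finset.ext fun p => ?_)
    exact (mem_map_iff _ _ _).trans ⟨fun ⟨q, hq, h⟩ => by rwa [← h, smulHom_apply,
      one_smul], fun h => ⟨p, h, one_smul G p⟩⟩
  mul_smul g k c := by
    refine PartialOrder.NonemptyFiniteChains.ext (Finset.ext fun p => ?_)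
    refine (mem_map_iff _ _ _).trans (Iff.trans ?_ (mem_map_iff _ _ _).symm)
    constructor
    · rintro ⟨q, hq, rfl⟩
      exact ⟨k • q, (mem_map_iff _ _ _).2 ⟨q, hq, rfl⟩, (mul_smul g k q).symm⟩
    · rintro ⟨r, hr, rfl⟩
      obtain ⟨q, hq, rfl⟩ := (mem_map_iff _ _ _).1 hr
      exact ⟨q, hq, mul_smul g k q⟩

instance {G : Type*} [Group G] [MulAction G P] [CovariantClass G P (· • ·) (· ≤ ·)] :
    CovariantClass G (PosetSd P) (· • ·) (· ≤ ·) where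
  elim g _ _ h := (orderHomMap (smulHom g)).monotone h

variable {G : Type*} [Group G] [MulAction G P] [CovariantClass G P (· • ·) (· ≤ ·)]
  [MulAction G Q] [CovariantClass G Q (· • ·) (· ≤ ·)]

theorem mem_smul_iff (g : G) (c : PosetSd P) (p : P) :
    p ∈ (g • c).finset ↔ g⁻¹ • p ∈ c.finset := by
  refine (mem_map_iff c (smulHom g) p).trans ⟨?_, fun h => ⟨_, h, smul_inv_smul g p⟩⟩
  rintro ⟨q, hq, rfl⟩
  rwa [smulHom_apply, inv_smul_smul]

theorem card_smul (g : G) (c : PosetSd P) : (g • c).finset.card = c.finset.card := by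
  refine (Finset.card_bij (fun p _ => g • p) (fun p hp => ?_)
    (fun p _ q _ h => MulAction.injective g h) (fun p hp => ?_)).symm
  · rwa [mem_smul_iff, inv_smul_smul]
  · exact ⟨g⁻¹ • p, (mem_smul_iff g c p).1 hp, smul_inv_smul g p⟩

/-- Greatest elements are unique and translations preserve the order in both directions. -/
theorem last_smul (g : G) (c : PosetSd P) : last P (g • c) = g • last P c := by
  refine le_antisymm ?_ (le_last ?_)
  · have h := le_last ((mem_smul_iff g c _).1 (last_mem (g • c)))
    simpa using (CovariantClass.elim g h : g • g⁻¹ • last P (g • c) ≤ g • last P c)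
  · rw [mem_smul_iff, inv_smul_smul]
    exact last_mem c

theorem orderHomMap_smul {f : P →o Q} (hf : ∀ (g : G) (p : P), f (g • p) = g • f p)
    (g : G) (c : PosetSd P) : orderHomMap f (g • c) = g • orderHomMap f c := by
  refine PartialOrder.NonemptyFiniteChains.ext (Finset.ext fun q => ?_)
  rw [mem_smul_iff, orderHomMap_coe, orderHomMap_coe, mem_map_iff, mem_map_iff]
  constructor
  · rintro ⟨p, hp, rfl⟩
    exact ⟨g⁻¹ • p, (mem_smul_iff g c p).1 hp, hf _ _⟩
  · rintro ⟨p, hp, h⟩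
    exact ⟨g • p, (mem_smul_iff g c _).2 (by rwa [inv_smul_smul]), by
      rw [hf, h, smul_inv_smul]⟩

end

/-! ### The canonical homeomorphism up to equivariant homotopy -/

variable {P Q : Type*} [Fintype P] [PartialOrder P] [Fintype Q] [PartialOrder Q]

/-- Translating a chain preserves its cardinality, hence the weights of its barycenter. -/
theorem isEquivariantMap_homeo {G : Type*} [Group G] [MulAction G P]
    [CovariantClass G P (· • ·) (· ≤ ·)] :
    IsEquivariantMap G
      (homeo P : C(PosetRealization (PosetSd P), PosetRealization P)) := by
  classical
  intro g y
  refine coord_injective (funext fun p => ?_)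
  rw [coord_smul]
  change baryFun (g • y).coord p = baryFun y.coord (g⁻¹ • p)
  unfold baryFun
  refine (Equiv.sum_comp (MulAction.toPerm g) _).symm.trans ?_
  simp [mem_smul_iff, coord_smul, card_smul]

theorem exists_of_coord_homeo_ne_zero {y : PosetRealization (PosetSd P)} {p : P}
    (h : (homeo P y).coord p ≠ 0) : ∃ c : PosetSd P, y.coord c ≠ 0 ∧ p ∈ c.finset :=
  exists_of_baryFun_ne_zero h

/-- The elements of the image under `f` of the chains supporting a point of `|sd P|` form a
chain. -/
theorem isChain_carrier {Q : Type*} [PartialOrder Q] (f : P →o Q)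
    (y : PosetRealization (PosetSd P)) :
    IsChain (· ≤ ·) {q | ∃ c : PosetSd P, y.coord c ≠ 0 ∧ ∃ p ∈ c.finset, f p = q} := by
  rintro _ ⟨c, hc, p, hp, rfl⟩ _ ⟨d, hd, q, hq, rfl⟩ _
  have h : p ≤ q ∨ q ≤ p := by
    rcases y.isChain_coord.total hc hd with h | h
    · exact d.comparable ⟨p, h hp⟩ ⟨q, hq⟩
    · exact c.comparable ⟨p, hp⟩ ⟨q, h hq⟩
  exact h.imp (fun h => f.monotone h) (fun h => f.monotone h)

variable {G : Type*} [Group G] [MulAction G P] [CovariantClass G P (· • ·) (· ≤ ·)]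
  [MulAction G Q] [CovariantClass G Q (· • ·) (· ≤ ·)]

/-- The last vertex map is equivariantly homotopic to the canonical homeomorphism. -/
theorem last_homotopicWith_homeo :
    (map (last P)).HomotopicWith
      (homeo P : C(PosetRealization (PosetSd P), PosetRealization P)) (IsEquivariantMap G) := by
  -- Both images of `y` lie in the simplex spanned by the union of the chains supporting `y`; this
  -- is the carrier of `y` for the identity map.
  refine homotopicWith_of_isChain (isEquivariantMap_map last_smul) isEquivariantMap_homeo
    fun y => (isChain_carrier OrderHom.id y).mono ?_
  rintro q (hq | hq)
  · obtain ⟨c, hc, rfl⟩ := exists_of_coord_map_ne_zero hq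
    exact ⟨c, hc, _, last_mem c, rfl⟩
  · obtain ⟨c, hc, hqc⟩ := exists_of_coord_homeo_ne_zero hq
    exact ⟨c, hc, q, hqc, rfl⟩

/-- The canonical homeomorphism is natural up to equivariant homotopy. -/
theorem map_comp_homeo_homotopicWith {f : P →o Q}
    (hf : ∀ (g : G) (p : P), f (g • p) = g • f p) :
    ((map f).comp
        (homeo P : C(PosetRealization (PosetSd P), PosetRealization P))).HomotopicWith
      ((homeo Q : C(PosetRealization (PosetSd Q), PosetRealization Q)).comp
        (map (orderHomMap f))) (IsEquivariantMap G) := by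
  -- Strict naturality fails when `f` is not injective on a chain: `|f|` weights the image of a
  -- barycenter by fibre sizes, while the barycenter of the image chain has equal weights. Both
  -- points still lie in the image under `f` of the carrier of `y`.
  refine homotopicWith_of_isChain ((isEquivariantMap_map hf).comp isEquivariantMap_homeo)
    (isEquivariantMap_homeo.comp (isEquivariantMap_map (orderHomMap_smul hf)))
    fun y => (isChain_carrier f y).mono ?_
  rintro q (hq | hq)
  · obtain ⟨p, hp, rfl⟩ := exists_of_coord_map_ne_zero hq
    obtain ⟨c, hc, hpc⟩ := exists_of_coord_homeo_ne_zero hp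
    exact ⟨c, hc, p, hpc, rfl⟩
  · obtain ⟨d, hd, hqd⟩ := exists_of_coord_homeo_ne_zero hq
    obtain ⟨c, hc, rfl⟩ := exists_of_coord_map_ne_zero hd
    obtain ⟨p, hp, rfl⟩ := (mem_map_iff c f q).1 hqd
    exact ⟨c, hc, p, hp, rfl⟩

end PosetSd

/-! ## The maps `F` and `G` -/

namespace DoubleOrder

open PosetRealization PartialOrder.NonemptyFiniteChains

variable {A : Type*}

theorem mapF_smul [Finite A] (σ : (Equiv.Perm A)ᵐᵒᵖ) (d : SemiRegularDoubleOrder A) :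
    mapF A (σ • d) = σ • mapF A d :=
  rfl

theorem mapG_smul (σ : (Equiv.Perm A)ᵐᵒᵖ) (c : PosetSd (RegularDoubleOrder A)) :
    mapG A (σ • c) = σ • mapG A c := by
  have key : ∀ p : RegularDoubleOrder A → Prop,
      (∃ d ∈ (σ • c).finset, p d) ↔ ∃ d ∈ c.finset, p (σ • d) := fun p =>
    ⟨fun ⟨d, hd, h⟩ => ⟨σ⁻¹ • d, (PosetSd.mem_smul_iff σ c d).1 hd, by rwa [smul_inv_smul]⟩,
      fun ⟨d, hd, h⟩ => ⟨σ • d, (PosetSd.mem_smul_iff σ c _).2 (by rwa [inv_smul_smul]), h⟩⟩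
  exact SemiRegularDoubleOrder.ext
    (funext fun a => funext fun b => propext (key fun d => d.x a b))
    (funext fun a => funext fun b => propext (key fun d => d.y a b))

/-- `F ∘ G` is the last vertex map. -/
theorem mapF_comp_mapG [Finite A] :
    (mapF A).comp (mapG A) = PosetSd.last (RegularDoubleOrder A) := by
  refine OrderHom.ext _ _ (funext fun c => ?_)
  obtain ⟨s, hs, hsc⟩ := PosetSd.exists_least c
  set t := PosetSd.last (RegularDoubleOrder A) c with ht
  have htm : t ∈ c.finset := PosetSd.last_mem c
  obtain ⟨hx, hy⟩ := mapG_eq c hs htm hsc fun d hd => PosetSd.le_last hd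
  have hst : s ≤ t := hsc t htm
  refine RegularDoubleOrder.ext hx ?_
  change relDiff (mapG A c).y (mapG A c).x = t.y
  rw [hx, hy]
  funext a b
  -- The inclusion of `t.y` uses `t.y ⊆ s.y`, from `s ⊑ t`, and regularity of `t`: no pair is
  -- comparable by both of its orders.
  refine propext ⟨fun ⟨h, h1, h2⟩ => ?_, fun h =>
    ⟨hst.2 a b h, fun k => (t.regular.2 a b k).1 h, fun k => (t.regular.2 b a k).2 h⟩⟩
  -- Conversely, a pair in `s.y` not comparable by `t.x` must be comparable by `t.y`. The reversed
  -- direction would, by `t.y ⊆ s.y`, give a cycle in `s.y`.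
  have hab : a ≠ b := by
    rintro rfl
    exact s.strict_y.irrefl a h
  rcases t.comparable a b hab with k | k | k | k
  · exact absurd k h1
  · exact absurd k h2
  · exact k
  · exact absurd (s.strict_y.trans a b a h (hst.2 b a k)) (s.strict_y.irrefl a)

/-- `G ∘ sd F` is bounded by the last vertex map. -/
theorem mapG_comp_sd_mapF_le [Finite A] :
    (mapG A).comp (orderHomMap (mapF A)) ≤ PosetSd.last (SemiRegularDoubleOrder A) := by
  intro c
  -- Each `F e` keeps the first order of `e` and only deletes pairs from the second, and every `e`
  -- in the chain lies below its last vertex.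
  constructor
  · rintro a b ⟨d, hd, h⟩
    obtain ⟨e, he, rfl⟩ := (mem_map_iff c (mapF A) d).1 hd
    exact (PosetSd.le_last he).1 a b h
  · rintro a b ⟨d, hd, h⟩
    obtain ⟨e, he, rfl⟩ := (mem_map_iff c (mapF A) d).1 hd
    exact (PosetSd.le_last he).2 a b h.1

/-! ### The two equivariant homotopies -/

theorem isEquivariantMap_realF [Finite A] : IsEquivariantMap (Equiv.Perm A)ᵐᵒᵖ (realF A) :=
  isEquivariantMap_map mapF_smul

theorem isEquivariantMap_realG [Finite A] : IsEquivariantMap (Equiv.Perm A)ᵐᵒᵖ (realG A) :=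
  (isEquivariantMap_map mapG_smul).comp PosetSd.isEquivariantMap_homeo.homeomorph_symm

theorem realG_comp_homeo [Finite A] :
    (realG A).comp (PosetSd.homeo (RegularDoubleOrder A) : C(_, _)) = map (mapG A) := by
  refine ContinuousMap.ext fun y => congrArg (map (mapG A)) ?_
  exact (PosetSd.homeo (RegularDoubleOrder A)).symm_apply_apply y

theorem realF_comp_realG_homotopicWith_id [Finite A] :
    ((realF A).comp (realG A)).HomotopicWith (ContinuousMap.id _)
      (IsEquivariantMap (Equiv.Perm A)ᵐᵒᵖ) := by
  refine .of_comp_homeomorph PosetSd.isEquivariantMap_homeo ?_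
  rw [ContinuousMap.comp_assoc, realG_comp_homeo, realF, map_comp, mapF_comp_mapG,
    ContinuousMap.id_comp]
  exact PosetSd.last_homotopicWith_homeo

theorem realG_comp_realF_homotopicWith_id [Finite A] :
    ((realG A).comp (realF A)).HomotopicWith (ContinuousMap.id _)
      (IsEquivariantMap (Equiv.Perm A)ᵐᵒᵖ) := by
  refine .of_comp_homeomorph PosetSd.isEquivariantMap_homeo ?_
  rw [ContinuousMap.comp_assoc, ContinuousMap.id_comp]
  -- Naturality for `F`, followed by `realG`, brings the canonical homeomorphism next to its inverse
  -- inside `realG`; they cancel and leave the realization of `G ∘ sd F`.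
  have h := (PosetSd.map_comp_homeo_homotopicWith (f := mapF A)
    (mapF_smul (A := A))).postcomp_equivariant isEquivariantMap_realG
  rw [← ContinuousMap.comp_assoc _ _ (map (orderHomMap (mapF A))), realG_comp_homeo,
    map_comp] at h
  -- The remaining path goes from `|G ∘ sd F|` to the last vertex map by the prism, and from there
  -- to the canonical homeomorphism.
  refine h.trans (.trans ?_ PosetSd.last_homotopicWith_homeo)
  refine homotopicWith_of_le (fun σ c => ?_) PosetSd.last_smul mapG_comp_sd_mapF_le
  exact (congrArg (mapG A) (PosetSd.orderHomMap_smul mapF_smul σ c)).trans (mapG_smul σ _)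

end DoubleOrder

theorem propositionp (A : Type*) [Finite A] :
    AreEquivariantHomotopyInverses (Equiv.Perm A)ᵐᵒᵖ
      (DoubleOrder.realF A) (DoubleOrder.realG A) :=
  ⟨DoubleOrder.isEquivariantMap_realF, DoubleOrder.isEquivariantMap_realG,
    DoubleOrder.realG_comp_realF_homotopicWith_id, DoubleOrder.realF_comp_realG_homotopicWith_id⟩
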